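/- Let $d\ge 2$. For every $c>0$ there is a constant $K$ (depending only on $d$ and $c$) such that the following holds for every odd positive integer $L$, all integers $N,j\ge 0$ and every $m>0$. Let $\Lambda=(\mathbb Z/L^N\mathbb Z)^d$ be the discrete torus with its nearest neighbour graph distance $d(\cdot,\cdot)$, let $\mathcal E=\{\pm e_1,\dots,\pm e_d\}$, $\partial_e f(x)=f(x+e)-f(x)$ and $\Delta f(x)=\sum_{e\in\mathcal E}\partial_e f(x)$. For $X\subset\Lambda$ let $\partial X=\{y\in\Lambda: d(y,X)=1\}$, and let $P_X(\cdot,y)$, $y\in\partial X$, be the Poisson kernel of $-\Delta+m^2$, i.e. the unique function with $(-\Delta+m^2)P_X(\cdot,y)=0$ in $X$ and $P_X(z,y)=\delta_{z,y}$ for $z\notin X$. For $U\subset\Lambda$ let $C_U$ be the Green's function of $-\Delta+m^2$ on $U$ with zero Dirichlet condition outside $U$, i.e. $(-\Delta+m^2)C_U(\cdot,y)=\delta_y$ in $U$ and $C_U(\cdot,y)=0$ outside $U$. If $x\in X\subset U\subset\Lambda$ and $d(x,\partial X)\ge cL^j$ (with $d(x,\emptyset)=\infty$), then for every $e\in\mathcal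 E$ $$\Big|\sum_{y_1,y_2\in\partial X}\partial_{x,e}P_X(x,y_1)\,C_U(y_1,y_2)\,\partial_{x,e}P_X(x,y_2)\Big|\le K\,L^{-dj},$$ where $\partial_{x,e}$ is the lattice derivative in the argument $x$ in direction $e$. -/

import Mathlib

namespace DipoleGas

/-- The discrete torus `(ℤ/nℤ)^d`.  The torus `Λ` of side `L ^ N` is `Torus d (L ^ N)`. -/
abbrev Torus (d n : ℕ) : Type := Fin d → ZMod n

/-- The lattice vector `e_k`. -/
def unitVec (d n : ℕ) (k : Fin d) : Torus d n := Pi.single k 1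

/-- The `2d` lattice directions `± e_k`. -/
def directions (d n : ℕ) : Set (Torus d n) :=
  {e | ∃ k : Fin d, e = unitVec d n k ∨ e = -unitVec d n k}

/-- The nearest neighbour graph of the torus. -/
def torusGraph (d n : ℕ) : SimpleGraph (Torus d n) :=
  SimpleGraph.fromRel fun x y => ∃ e ∈ directions d n, x = y + e

/-- The distance from a site `x` to a set `S` of sites: the least length of a nearest neighbour
path in the torus from `x` to a point of `S` (it is `⊤` if `S` is empty). -/
noncomputable def distTo {d n : ℕ} (x : Torus d n) (S : Finset (Torus d n)) : ℕ∞ :=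
  ⨅ y ∈ S, (torusGraph d n).edist x y

open Classical in
/-- The outer boundary `∂X`: the sites at distance one from `X`. -/
noncomputable def outerBoundary {d n : ℕ} [NeZero n] (X : Finset (Torus d n)) :
    Finset (Torus d n) :=
  Finset.univ.filter fun y => distTo y X = 1

/-- The lattice derivative `∂_e f (x) = f (x + e) - f x`. -/
def latticeDeriv {d n : ℕ} (e : Torus d n) (f : Torus d n → ℝ) (x : Torus d n) : ℝ :=
  f (x + e) - f x

/-- The lattice Laplacian: the sum of `∂_e f (x)` over the `2d` directions `e`. -/
def laplacian {d n : ℕ} (f : Torus d n → ℝ) (x : Torus d n) : ℝ :=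
  ∑ k : Fin d, (latticeDeriv (unitVec d n k) f x + latticeDeriv (-unitVec d n k) f x)

/-- The operator `-Δ + m²`. -/
def massiveOp {d n : ℕ} (m : ℝ) (f : Torus d n → ℝ) (x : Torus d n) : ℝ :=
  -laplacian f x + m ^ 2 * f x

/-- `u` solves the Dirichlet problem `(-Δ + m²) u = ρ` in `X`, `u = f` outside `X`. -/
def IsDirichletSolution {d n : ℕ} (m : ℝ) (X : Finset (Torus d n)) (ρ f u : Torus d n → ℝ) :
    Prop :=
  (∀ x ∈ X, massiveOp m u x = ρ x) ∧ ∀ x ∉ X, u x = f x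

open Classical in
/-- The linear map `u ↦ ((-Δ + m²) u on X, u off X)` of the Dirichlet problem. -/
noncomputable def dirichletMap {d n : ℕ} (m : ℝ) (X : Finset (Torus d n)) :
    (Torus d n → ℝ) →ₗ[ℝ] (Torus d n → ℝ) where
  toFun u x := if x ∈ X then massiveOp m u x else u x
  map_add' u v := by
    funext x
    by_cases hx : x ∈ X
    · have h : laplacian (u + v) x = laplacian u x + laplacian v x := by
        simp only [laplacian, ← Finset.sum_add_distrib]
        refine Finset.sum_congr rfl fun k _ => ?_
        simp only [latticeDeriv, Pi.add_apply]
        ring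
      simp only [hx, if_true, massiveOp, h, Pi.add_apply]
      ring
    · simp [hx]
  map_smul' a u := by
    funext x
    by_cases hx : x ∈ X
    · have h : laplacian (a • u) x = a * laplacian u x := by
        simp only [laplacian, Finset.mul_sum]
        refine Finset.sum_congr rfl fun k _ => ?_
        simp only [latticeDeriv, Pi.smul_apply, smul_eq_mul]
        ring
      simp only [hx, if_true, massiveOp, h, Pi.smul_apply, smul_eq_mul, RingHom.id_apply]
      ring
    · simp [hx]

theorem dirichletMap_injective {d n : ℕ} [NeZero n] {m : ℝ} (hm : 0 < m)
    (X : Finset (Torus d n)) : Function.Injective (dirichletMap (d := d) (n := n) m X) := by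
  rw [← LinearMap.ker_eq_bot, LinearMap.ker_eq_bot']
  intro u hu
  obtain ⟨x, hx⟩ := Finite.exists_max fun x => |u x|
  have key : u x = 0 := by
    have hux := congrFun hu x
    by_cases hX : x ∈ X
    · have h1 : -laplacian u x + m ^ 2 * u x = 0 := by
        simpa [dirichletMap, hX, massiveOp] using hux
      have h2 : laplacian u x * u x ≤ 0 := by
        rw [laplacian, Finset.sum_mul]
        refine Finset.sum_nonpos fun k _ => ?_
        have hle : ∀ y, u y * u x ≤ u x * u x := fun y =>
          calc u y * u x ≤ |u y * u x| := le_abs_self _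
            _ = |u y| * |u x| := abs_mul _ _
            _ ≤ |u x| * |u x| := mul_le_mul_of_nonneg_right (hx y) (abs_nonneg _)
            _ = u x * u x := abs_mul_abs_self _
        have := hle (x + unitVec d n k)
        have := hle (x + -unitVec d n k)
        simp only [latticeDeriv]
        nlinarith
      have h3 : m ^ 2 * (u x * u x) ≤ 0 :=
        le_of_eq_of_le (by linear_combination (u x) * h1) h2
      have h4 : u x * u x ≤ 0 := nonpos_of_mul_nonpos_right h3 (by positivity)
      exact mul_self_eq_zero.mp (le_antisymm h4 (mul_self_nonneg _))
    · simpa [dirichletMap, hX] using hux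
  funext y
  have := hx y
  simp only [key, abs_zero] at this
  simpa using this

/-- For `m > 0` the Dirichlet problem has exactly one solution. -/
theorem existsUnique_isDirichletSolution {d n : ℕ} [NeZero n] {m : ℝ} (hm : 0 < m)
    (X : Finset (Torus d n)) (ρ f : Torus d n → ℝ) : ∃! u, IsDirichletSolution m X ρ f u := by
  classical
  have hiff : ∀ u, IsDirichletSolution m X ρ f u ↔
      dirichletMap m X u = fun x => if x ∈ X then ρ x else f x := by
    intro u
    constructor
    · rintro ⟨h1, h2⟩
      funext x
      by_cases hx : x ∈ X
      · simpa [dirichletMap, hx] using h1 x hx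
      · simpa [dirichletMap, hx] using h2 x hx
    · intro h
      refine ⟨fun x hx => ?_, fun x hx => ?_⟩
      · simpa [dirichletMap, hx] using congrFun h x
      · simpa [dirichletMap, hx] using congrFun h x
  simp only [hiff]
  have hinj := dirichletMap_injective hm X
  have hsurj : Function.Surjective (dirichletMap (d := d) (n := n) m X) :=
    LinearMap.injective_iff_surjective.mp hinj
  exact Function.Bijective.existsUnique ⟨hinj, hsurj⟩ _

/-- The solution of the Dirichlet problem `(-Δ + m²) u = ρ` in `X`, `u = f` outside `X`. -/
noncomputable def dirichletSolution {d n : ℕ} [NeZero n] {m : ℝ} (hm : 0 < m)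
    (X : Finset (Torus d n)) (ρ f : Torus d n → ℝ) : Torus d n → ℝ :=
  (existsUnique_isDirichletSolution hm X ρ f).exists.choose

theorem dirichletSolution_spec {d n : ℕ} [NeZero n] {m : ℝ} (hm : 0 < m)
    (X : Finset (Torus d n)) (ρ f : Torus d n → ℝ) :
    IsDirichletSolution m X ρ f (dirichletSolution hm X ρ f) :=
  (existsUnique_isDirichletSolution hm X ρ f).exists.choose_spec

/-- `P_X f`: the `(-Δ + m²)`-harmonic extension into `X` of the values of `f` outside `X`,
these values being kept. -/
noncomputable def harmonicExtension {d n : ℕ} [NeZero n] {m : ℝ} (hm : 0 < m)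
    (X : Finset (Torus d n)) (f : Torus d n → ℝ) : Torus d n → ℝ :=
  dirichletSolution hm X 0 f

/-- The Poisson kernel `P_X(x, y)`, for `y` outside `X`, with the convention
`P_X(x, y) = δ_{x,y}` for `x` outside `X`. -/
noncomputable def poissonKernel {d n : ℕ} [NeZero n] {m : ℝ} (hm : 0 < m)
    (X : Finset (Torus d n)) (x y : Torus d n) : ℝ :=
  harmonicExtension hm X (Pi.single y 1) x

/-- The Dirichlet Green's function `C_U(x, y)` of `-Δ + m²` on `U`, extended by zero: in `x` it
solves `(-Δ + m²) C_U(·, y) = δ_y` in `U` and vanishes outside `U`. -/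
noncomputable def greenFunction {d n : ℕ} [NeZero n] {m : ℝ} (hm : 0 < m)
    (U : Finset (Torus d n)) (x y : Torus d n) : ℝ :=
  dirichletSolution hm U (Pi.single y 1) 0 x

end DipoleGas

namespace DipoleGas

/-! ### Energy identities and the Dirichlet principle -/

section Energy

variable {d n : ℕ}

/-! Write `M` for `-Δ + m²`, `g y = ∂_e P_X(x, y)` on `∂X`, and `u = ∑ y ∈ ∂X, C_U(·, y) g y`. The
double sum is `E = ∑ y ∈ ∂X, g y * u y`, and it appears in two further guises. It is the energy `∑
z, u z * M u z` (`greenFunction_quadratic_form`), hence nonnegative; and it is `∂_e h (x)`, where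
`h` is the harmonic extension of `u` into `X` (`harmonicExtension_eq_sum`). A gradient bound `(∂_e h
(x))² ≤ κ * energy h` with `κ = K L^{-dj}` (`sq_latticeDeriv_le`) and the Dirichlet principle
`energy h ≤ energy u = E` (`energy_harmonicExtension_le`) then give `E² ≤ κ E`, so `E ≤ κ`. No
pointwise estimate of `C_U` or `P_X` is needed. For the gradient bound, `v = ∂_e h` again satisfies
`Δ v = m² v` near `x`, and `∑ v²` is at most the energy of `h`. The mean value inequality `v(x)² ≤
(C / l)^d ∑ v²` (`sq_le_of_massive_harmonic`), at a scale `l` comparable to `L^j`, comes from a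
one-dimensional Sobolev inequality used once per coordinate, each derivative so produced being
removed by Caccioppoli's inequality. All constants are independent of `m`, since the mass term has a
favourable sign. -/

theorem laplacian_sub (f g : Torus d n → ℝ) (x : Torus d n) :
    laplacian (fun z => f z - g z) x = laplacian f x - laplacian g x := by
  simp only [laplacian, ← Finset.sum_sub_distrib]
  refine Finset.sum_congr rfl fun k _ => ?_
  simp only [latticeDeriv]
  ring

theorem massiveOp_sub (m : ℝ) (f g : Torus d n → ℝ) (x : Torus d n) :
    massiveOp m (fun z => f z - g z) x = massiveOp m f x - massiveOp m g x := by
  simp only [massiveOp, laplacian_sub]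
  ring

theorem massiveOp_sum_mul {ι : Type*} (m : ℝ) (s : Finset ι) (F : ι → Torus d n → ℝ) (a : ι → ℝ)
    (x : Torus d n) :
    massiveOp m (fun z => ∑ i ∈ s, F i z * a i) x = ∑ i ∈ s, massiveOp m (F i) x * a i := by
  have h : laplacian (fun z => ∑ i ∈ s, F i z * a i) x = ∑ i ∈ s, laplacian (F i) x * a i := by
    simp only [laplacian, latticeDeriv, Finset.sum_mul]
    rw [Finset.sum_comm]
    refine Finset.sum_congr rfl fun k _ => ?_
    rw [← Finset.sum_sub_distrib, ← Finset.sum_sub_distrib, ← Finset.sum_add_distrib]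
    exact Finset.sum_congr rfl fun i _ => by ring
  rw [massiveOp, h, Finset.mul_sum, ← Finset.sum_neg_distrib, ← Finset.sum_add_distrib]
  refine Finset.sum_congr rfl fun i _ => ?_
  rw [massiveOp]
  ring

theorem massiveOp_congr (m : ℝ) {f g : Torus d n → ℝ} {x : Torus d n} (h0 : f x = g x)
    (h : ∀ e ∈ directions d n, f (x + e) = g (x + e)) : massiveOp m f x = massiveOp m g x := by
  have : laplacian f x = laplacian g x := by
    refine Finset.sum_congr rfl fun k _ => ?_
    simp only [latticeDeriv, h0, h _ ⟨k, Or.inl rfl⟩, h _ ⟨k, Or.inr rfl⟩]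
  rw [massiveOp, massiveOp, this, h0]

/-- Lattice derivatives commute with the Laplacian. -/
theorem laplacian_latticeDeriv (e : Torus d n) (f : Torus d n → ℝ) (x : Torus d n) :
    laplacian (latticeDeriv e f) x = laplacian f (x + e) - laplacian f x := by
  simp only [laplacian, ← Finset.sum_sub_distrib]
  refine Finset.sum_congr rfl fun k _ => ?_
  simp only [latticeDeriv, add_right_comm x _ e]
  ring

variable [NeZero n]

theorem sum_comp_add (e : Torus d n) (f : Torus d n → ℝ) : ∑ z, f (z + e) = ∑ z, f z :=
  Equiv.sum_comp (Equiv.addRight e) f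

/-- Summation by parts on the torus. -/
theorem sum_mul_neg_laplacian (f g : Torus d n → ℝ) :
    ∑ z, f z * -laplacian g z =
      ∑ k, ∑ z, latticeDeriv (unitVec d n k) f z * latticeDeriv (unitVec d n k) g z := by
  simp only [laplacian, ← Finset.sum_neg_distrib, Finset.mul_sum]
  rw [Finset.sum_comm]
  refine Finset.sum_congr rfl fun k _ => ?_
  set e := unitVec d n k
  have h1 := sum_comp_add e fun z => f z * g z
  have h2 := sum_comp_add e fun z => f z * g (z + -e)
  simp only [add_neg_cancel_right] at h2
  have h3 : ∀ z, latticeDeriv e f z * latticeDeriv e g z =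
      f (z + e) * g (z + e) - f (z + e) * g z - f z * g (z + e) + f z * g z := fun z => by
    simp only [latticeDeriv]; ring
  have h4 : ∀ z, f z * -(latticeDeriv e g z + latticeDeriv (-e) g z) =
      f z * g z + f z * g z - f z * g (z + e) - f z * g (z + -e) := fun z => by
    simp only [latticeDeriv]; ring
  simp only [h3, h4, Finset.sum_add_distrib, Finset.sum_sub_distrib, h1, h2]
  ring

theorem sum_mul_massiveOp (m : ℝ) (f g : Torus d n → ℝ) :
    ∑ z, f z * massiveOp m g z =
      ∑ k, ∑ z, latticeDeriv (unitVec d n k) f z * latticeDeriv (unitVec d n k) g z +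
        m ^ 2 * ∑ z, f z * g z := by
  rw [← sum_mul_neg_laplacian, Finset.mul_sum, ← Finset.sum_add_distrib]
  refine Finset.sum_congr rfl fun z _ => ?_
  simp only [massiveOp]
  ring

theorem sum_mul_massiveOp_comm (m : ℝ) (f g : Torus d n → ℝ) :
    ∑ z, f z * massiveOp m g z = ∑ z, g z * massiveOp m f z := by
  rw [sum_mul_massiveOp, sum_mul_massiveOp]
  congr 1
  · exact Finset.sum_congr rfl fun k _ => Finset.sum_congr rfl fun z _ => mul_comm _ _
  · exact congrArg _ (Finset.sum_congr rfl fun z _ => mul_comm _ _)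

theorem sum_sq_latticeDeriv_unitVec_le (m : ℝ) (f : Torus d n → ℝ) (k : Fin d) :
    ∑ z, latticeDeriv (unitVec d n k) f z ^ 2 ≤ ∑ z, f z * massiveOp m f z := by
  rw [sum_mul_massiveOp]
  simp only [← pow_two]
  have h1 : 0 ≤ m ^ 2 * ∑ z, f z ^ 2 := by positivity
  have h2 := Finset.single_le_sum
    (f := fun k => ∑ z, latticeDeriv (unitVec d n k) f z ^ 2)
    (fun i _ => Finset.sum_nonneg fun z _ => sq_nonneg _) (Finset.mem_univ k)
  linarith

theorem sum_mul_massiveOp_nonneg (m : ℝ) (f : Torus d n → ℝ) :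
    0 ≤ ∑ z, f z * massiveOp m f z := by
  rw [sum_mul_massiveOp]
  simp only [← pow_two]
  positivity

theorem sum_sq_latticeDeriv_le (m : ℝ) (f : Torus d n → ℝ) {e : Torus d n}
    (he : e ∈ directions d n) :
    ∑ z, latticeDeriv e f z ^ 2 ≤ ∑ z, f z * massiveOp m f z := by
  obtain ⟨k, rfl | rfl⟩ := he
  · exact sum_sq_latticeDeriv_unitVec_le m f k
  · rw [← sum_comp_add (unitVec d n k)]
    refine le_trans (le_of_eq ?_) (sum_sq_latticeDeriv_unitVec_le m f k)
    refine Finset.sum_congr rfl fun z _ => ?_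
    simp only [latticeDeriv, add_neg_cancel_right]
    ring

/-- The Dirichlet principle: the harmonic extension does not increase the energy. -/
theorem energy_harmonicExtension_le {m : ℝ} (hm : 0 < m) (X : Finset (Torus d n))
    (u : Torus d n → ℝ) :
    ∑ z, harmonicExtension hm X u z * massiveOp m (harmonicExtension hm X u) z ≤
      ∑ z, u z * massiveOp m u z := by
  obtain ⟨h1, h2⟩ := dirichletSolution_spec hm X 0 u
  change ∀ x ∈ X, massiveOp m (harmonicExtension hm X u) x = _ at h1
  change ∀ x ∉ X, harmonicExtension hm X u x = _ at h2
  set h := harmonicExtension hm X u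
  -- Orthogonality: `u - h` vanishes off `X` and `massiveOp m h` vanishes on `X`, so the cross terms
  -- drop out of the energy of `u = h + (u - h)`.
  have hz : ∑ z, (u z - h z) * massiveOp m h z = 0 := by
    refine Finset.sum_eq_zero fun z _ => ?_
    by_cases hz : z ∈ X
    · simp [h1 z hz]
    · simp [h2 z hz]
  have hz' := sum_mul_massiveOp_comm m (fun z => u z - h z) h
  have hp := sum_mul_massiveOp_nonneg m (fun z => u z - h z)
  have : ∑ z, u z * massiveOp m u z = ∑ z, h z * massiveOp m h z +
      ∑ z, (u z - h z) * massiveOp m h z +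
      ∑ z, h z * massiveOp m (fun z => u z - h z) z +
      ∑ z, (u z - h z) * massiveOp m (fun z => u z - h z) z := by
    simp only [← Finset.sum_add_distrib]
    refine Finset.sum_congr rfl fun z _ => ?_
    rw [massiveOp_sub]
    ring
  rw [this, ← hz', hz]
  linarith

end Energy

/-! ### Caccioppoli and mean value inequalities -/

section Regularity

/-- One-dimensional Sobolev inequality at scale `l`: average `f 0 ^ 2 ≤ 2 * f t ^ 2 + 2 * (f t - f
0) ^ 2` over `t < l`, with Cauchy–Schwarz on the telescoping sum for `f t - f 0`. -/
theorem sq_le_sum_sq_add_sum_sq_diff (f : ℕ → ℝ) {l : ℕ} (hl : 0 < l) :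
    f 0 ^ 2 ≤ 2 / l * ∑ t ∈ Finset.range l, f t ^ 2 +
      2 * l * ∑ t ∈ Finset.range l, (f (t + 1) - f t) ^ 2 := by
  have hl' : (0 : ℝ) < l := by exact_mod_cast hl
  set S := ∑ t ∈ Finset.range l, (f (t + 1) - f t) ^ 2
  have hS : 0 ≤ S := Finset.sum_nonneg fun _ _ => sq_nonneg _
  have key : ∀ t ∈ Finset.range l, f 0 ^ 2 ≤ 2 * f t ^ 2 + 2 * l * S := by
    intro t ht
    have htl := (Finset.mem_range.mp ht).le
    have h1 : ∑ r ∈ Finset.range t, (f (r + 1) - f r) = f t - f 0 := Finset.sum_range_sub f t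
    have h2 := sq_sum_le_card_mul_sum_sq (s := Finset.range t) (f := fun r => f (r + 1) - f r)
    rw [h1, Finset.card_range] at h2
    have h3 : ∑ r ∈ Finset.range t, (f (r + 1) - f r) ^ 2 ≤ S :=
      Finset.sum_le_sum_of_subset_of_nonneg (Finset.range_mono htl) fun _ _ _ => sq_nonneg _
    have h4 : (t : ℝ) * ∑ r ∈ Finset.range t, (f (r + 1) - f r) ^ 2 ≤ l * S := by
      gcongr
    nlinarith [sq_nonneg (2 * f t - f 0)]
  have h := Finset.sum_le_sum key
  rw [Finset.sum_const, Finset.card_range, nsmul_eq_mul, Finset.sum_add_distrib,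
    ← Finset.mul_sum, Finset.sum_const, Finset.card_range, nsmul_eq_mul] at h
  have : 2 / l * ∑ t ∈ Finset.range l, f t ^ 2 + 2 * l * S =
      (2 * ∑ t ∈ Finset.range l, f t ^ 2 + l * (2 * l * S)) / l := by
    field_simp
  rw [this, le_div_iff₀ hl']
  linarith

variable {d n : ℕ}

/-- The sum of `v ^ 2` over the points `x + ∑ i < k, t i • e_i`, `0 ≤ t i < l`. -/
def cubeSum (d n l : ℕ) (v : Torus d n → ℝ) : ℕ → Torus d n → ℝ
  | 0, x => v x ^ 2
  | k + 1, x => if h : k < d then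
      ∑ t ∈ Finset.range l, cubeSum d n l v k (x + t • unitVec d n ⟨k, h⟩) else 0

/-- The one-dimensional inequality along `e_k`, summed over the base points of a `j`-dimensional
cube. For `j = k` the right side consists of `(k + 1)`-dimensional cube sums. -/
theorem cubeSum_le (l : ℕ) (hl : 0 < l) (v : Torus d n → ℝ) (k : Fin d) (j : ℕ) (hj : j ≤ d)
    (x : Torus d n) :
    cubeSum d n l v j x ≤
      2 / l * ∑ t ∈ Finset.range l, cubeSum d n l v j (x + t • unitVec d n k) +
      2 * l * ∑ t ∈ Finset.range l,
        cubeSum d n l (latticeDeriv (unitVec d n k) v) j (x + t • unitVec d n k) := by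
  induction j generalizing x with
  | zero =>
    have := sq_le_sum_sq_add_sum_sq_diff (fun t => v (x + t • unitVec d n k)) hl
    simpa [cubeSum, latticeDeriv, add_smul, ← add_assoc] using this
  | succ j ih =>
    have hj' : j < d := hj
    simp only [cubeSum, hj', dif_pos]
    refine (Finset.sum_le_sum fun t _ => ih hj'.le _).trans (le_of_eq ?_)
    rw [Finset.sum_add_distrib, ← Finset.mul_sum, ← Finset.mul_sum, Finset.sum_comm,
      Finset.sum_comm (f := fun t i => cubeSum d n l (latticeDeriv (unitVec d n k) v) j _)]
    simp only [add_right_comm x]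

theorem cubeSum_le_succ (l : ℕ) (hl : 0 < l) (v : Torus d n → ℝ) (k : Fin d) (x : Torus d n) :
    cubeSum d n l v k x ≤ 2 / l * cubeSum d n l v (k + 1) x +
      2 * l * cubeSum d n l (latticeDeriv (unitVec d n k) v) (k + 1) x := by
  have := cubeSum_le l hl v k k k.2.le x
  simpa [cubeSum] using this

/-- `ρ` changes by at most one along each edge of the torus. -/
def IsEdgeLipschitz (ρ : Torus d n → ℕ) : Prop :=
  ∀ k z, ρ (z + unitVec d n k) ≤ ρ z + 1 ∧ ρ z ≤ ρ (z + unitVec d n k) + 1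

variable [NeZero n]

/-- Caccioppoli's inequality. -/
theorem sum_sq_latticeDeriv_le_of_subharmonic {ρ : Torus d n → ℕ} (hρ : IsEdgeLipschitz ρ)
    {s l : ℕ} (hl : 0 < l) {v : Torus d n → ℝ}
    (hv : ∀ z, ρ z ≤ s + 3 * l → 0 ≤ v z * laplacian v z) :
    ∑ k, ∑ z with ρ z ≤ s, latticeDeriv (unitVec d n k) v z ^ 2 ≤
      d / (l : ℝ) ^ 2 * ∑ z with ρ z ≤ s + 3 * l, v z ^ 2 := by
  have hl' : (0 : ℝ) < l := by exact_mod_cast hl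
  have hl1 : (1 : ℝ) ≤ l := by exact_mod_cast hl
  -- Cutoff of slope `1 / l`. It stays equal to `1` up to `s + 1`, so that both ends of every edge
  -- starting in `ρ ≤ s` are covered.
  let η : Torus d n → ℝ := fun z => max 0 (min 1 ((s + 1 + l - ρ z) / l))
  have hη1 : ∀ z, ρ z ≤ s + 1 → η z = 1 := by
    intro z hz
    have hz' : (ρ z : ℝ) ≤ s + 1 := by exact_mod_cast hz
    have : (1 : ℝ) ≤ (s + 1 + l - ρ z) / l := by
      rw [le_div_iff₀ hl']; linarith
    simp [η, min_eq_left this]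
  have hη0 : ∀ z, s + 1 + l ≤ ρ z → η z = 0 := by
    intro z hz
    have hz' : (s + 1 + l : ℝ) ≤ ρ z := by exact_mod_cast hz
    have : (s + 1 + l - ρ z) / (l : ℝ) ≤ 0 := div_nonpos_of_nonpos_of_nonneg (by linarith) hl'.le
    exact max_eq_left ((min_le_right _ _).trans this)
  have hηd : ∀ k z, latticeDeriv (unitVec d n k) η z ^ 2 ≤ 1 / (l : ℝ) ^ 2 := by
    intro k z
    obtain ⟨h1, h2⟩ := hρ k z
    have h1' : (ρ (z + unitVec d n k) : ℝ) ≤ ρ z + 1 := by exact_mod_cast h1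
    have h2' : (ρ z : ℝ) ≤ ρ (z + unitVec d n k) + 1 := by exact_mod_cast h2
    have h3 : |latticeDeriv (unitVec d n k) η z| ≤ 1 / l := by
      refine (abs_max_sub_max_le_max 0 _ 0 _).trans (max_le (by simp) ?_)
      refine (abs_min_sub_min_le_max 1 _ 1 _).trans (max_le (by simp) ?_)
      rw [← sub_div, abs_div, abs_of_pos hl']
      gcongr
      rw [abs_le]
      constructor <;> linarith
    rw [← sq_abs, ← one_div_pow]
    gcongr
  have hparts := sum_mul_neg_laplacian (fun z => η z ^ 2 * v z) v
  have hneg : ∑ z, η z ^ 2 * v z * -laplacian v z ≤ 0 := by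
    refine Finset.sum_nonpos fun z _ => ?_
    by_cases hz : ρ z ≤ s + 3 * l
    · nlinarith [mul_nonneg (sq_nonneg (η z)) (hv z hz)]
    · rw [hη0 z (by omega)]
      simp
  -- An exact discrete product rule: the error contains only the derivative of `η`, so no gradient
  -- of `v` has to be absorbed.
  have hid : ∀ k z, latticeDeriv (unitVec d n k) (fun z => η z ^ 2 * v z) z *
      latticeDeriv (unitVec d n k) v z =
      latticeDeriv (unitVec d n k) (fun z => η z * v z) z ^ 2 -
        latticeDeriv (unitVec d n k) η z ^ 2 * (v z * v (z + unitVec d n k)) := by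
    intro k z
    simp only [latticeDeriv]
    ring
  simp only [hid, Finset.sum_sub_distrib] at hparts
  set V := ∑ z with ρ z ≤ s + 3 * l, v z ^ 2 with hV
  have hVi : V = ∑ z, if ρ z ≤ s + 3 * l then v z ^ 2 else 0 := Finset.sum_filter _ _
  have herr : ∀ k, ∑ z, latticeDeriv (unitVec d n k) η z ^ 2 *
      (v z * v (z + unitVec d n k)) ≤ 1 / (l : ℝ) ^ 2 * V := by
    intro k
    set I : Torus d n → ℝ := fun z => if ρ z ≤ s + 3 * l then v z ^ 2 else 0 with hI
    have hI0 : ∀ z, 0 ≤ I z := fun z => by simp only [hI]; split_ifs <;> positivity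
    have h1 : ∀ z, latticeDeriv (unitVec d n k) η z ^ 2 * (v z * v (z + unitVec d n k)) ≤
        1 / (l : ℝ) ^ 2 * ((I z + I (z + unitVec d n k)) / 2) := by
      intro z
      obtain ⟨h1, h2⟩ := hρ k z
      have hI1 := hI0 z
      have hI2 := hI0 (z + unitVec d n k)
      by_cases hz : ρ z ≤ s + 3 * l ∧ ρ (z + unitVec d n k) ≤ s + 3 * l
      · have e1 : I z = v z ^ 2 := if_pos hz.1
        have e2 : I (z + unitVec d n k) = v (z + unitVec d n k) ^ 2 := if_pos hz.2
        rw [e1, e2]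
        calc _ ≤ latticeDeriv (unitVec d n k) η z ^ 2 *
              ((v z ^ 2 + v (z + unitVec d n k) ^ 2) / 2) := by
              gcongr
              nlinarith [sq_nonneg (v z - v (z + unitVec d n k))]
          _ ≤ _ := by
              gcongr
              exact hηd k z
      -- If one end lies beyond `s + 3 * l`, the other has `ρ ≥ s + 3 * l ≥ s + 1 + l`, so `η` is
      -- zero at both ends.
      · have : latticeDeriv (unitVec d n k) η z = 0 := by
          rw [latticeDeriv, hη0 z (by omega), hη0 (z + unitVec d n k) (by omega), sub_zero]
        rw [this]
        simp only [ne_eq, OfNat.ofNat_ne_zero, not_false_eq_true, zero_pow, zero_mul]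
        positivity
    refine (Finset.sum_le_sum fun z _ => h1 z).trans (le_of_eq ?_)
    rw [← Finset.mul_sum, ← Finset.sum_div, Finset.sum_add_distrib, sum_comp_add _ I, hVi]
    ring
  have hmain : ∑ k, ∑ z with ρ z ≤ s, latticeDeriv (unitVec d n k) v z ^ 2 ≤
      ∑ k, ∑ z, latticeDeriv (unitVec d n k) (fun z => η z * v z) z ^ 2 := by
    refine Finset.sum_le_sum fun k _ => ?_
    calc _ = ∑ z with ρ z ≤ s, latticeDeriv (unitVec d n k) (fun z => η z * v z) z ^ 2 := by
          refine Finset.sum_congr rfl fun z hz => ?_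
          have hz := (Finset.mem_filter.mp hz).2
          have := (hρ k z).1
          simp only [latticeDeriv]
          rw [hη1 z (by omega), hη1 (z + unitVec d n k) (by omega), one_mul, one_mul]
      _ ≤ _ := Finset.sum_le_sum_of_subset_of_nonneg (Finset.filter_subset _ _)
          fun _ _ _ => sq_nonneg _
  have hsum : ∑ k, ∑ z, latticeDeriv (unitVec d n k) η z ^ 2 * (v z * v (z + unitVec d n k)) ≤
      d / (l : ℝ) ^ 2 * V := by
    refine (Finset.sum_le_sum fun k _ => herr k).trans (le_of_eq ?_)
    rw [Finset.sum_const, Finset.card_univ, Fintype.card_fin, nsmul_eq_mul]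
    ring
  linarith

/-- Since `l ≤ n`, the cube does not wrap around the torus and each site is counted at most once.
Fixing the coordinates `i ≥ k` is what makes the slices disjoint in the induction. -/
theorem cubeSum_le_sum_filter {l : ℕ} (hl : l ≤ n) (v : Torus d n → ℝ) {ρ : Torus d n → ℕ}
    (hρ : IsEdgeLipschitz ρ) (k : ℕ) (hk : k ≤ d) (x : Torus d n) :
    cubeSum d n l v k x ≤
      ∑ z with ρ z ≤ ρ x + k * l ∧ ∀ i : Fin d, k ≤ i → z i = x i, v z ^ 2 := by
  classical
  induction k generalizing x with
  | zero =>
    refine Finset.single_le_sum (f := fun z => v z ^ 2) (fun _ _ => sq_nonneg _) ?_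
    simp
  | succ k ih =>
    have hk' : k < d := hk
    simp only [cubeSum, hk', dif_pos]
    refine (Finset.sum_le_sum fun t _ => ih hk'.le _).trans ?_
    rw [← Finset.sum_biUnion]
    · refine Finset.sum_le_sum_of_subset_of_nonneg ?_ fun _ _ _ => sq_nonneg _
      intro z hz
      simp only [Finset.mem_biUnion, Finset.mem_filter, Finset.mem_univ, true_and,
        Finset.mem_range] at hz ⊢
      obtain ⟨t, ht, hz1, hz2⟩ := hz
      have hρt : ∀ t : ℕ, ρ (x + t • unitVec d n ⟨k, hk'⟩) ≤ ρ x + t := by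
        intro t
        induction t with
        | zero => simp
        | succ t iht =>
          rw [succ_nsmul, ← add_assoc]
          have := (hρ ⟨k, hk'⟩ (x + t • unitVec d n ⟨k, hk'⟩)).1
          omega
      have := hρt t
      refine ⟨by rw [add_mul, one_mul]; omega, fun i hi => ?_⟩
      rw [hz2 i (by omega)]
      have : i ≠ ⟨k, hk'⟩ := by rintro rfl; simp at hi
      simp [unitVec, this]
    · intro s hs t ht hst
      refine Finset.disjoint_left.mpr fun z hz1 hz2 => hst ?_
      have h1 := (Finset.mem_filter.mp hz1).2.2 ⟨k, hk'⟩ le_rfl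
      have h2 := (Finset.mem_filter.mp hz2).2.2 ⟨k, hk'⟩ le_rfl
      rw [h1] at h2
      simp only [Pi.add_apply, Pi.smul_apply, unitVec, Pi.single_eq_same, nsmul_one,
        add_right_inj] at h2
      have hs' : s < n := (Finset.mem_range.mp (by simpa using hs)).trans_le hl
      have ht' : t < n := (Finset.mem_range.mp (by simpa using ht)).trans_le hl
      rw [ZMod.natCast_eq_natCast_iff] at h2
      exact h2.eq_of_lt_of_lt hs' ht'

/-- Induction on the number `i` of missing dimensions. Adding a dimension costs `2 / l` for `v` and
`2 * l` for its derivative; Caccioppoli turns the latter into `2 * l * (d / l ^ 2)`, for a total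
factor `(2 + 2 * d) / l` and `3 * l` of extra radius. -/
theorem cubeSum_le_of_massive_harmonic {l : ℕ} (hl0 : 0 < l) (hl : l ≤ n) {ρ : Torus d n → ℕ}
    (hρ : IsEdgeLipschitz ρ) {x : Torus d n} (hx : ρ x = 0) {μ : ℝ} (hμ : 0 ≤ μ) (i k : ℕ)
    (hik : k + i = d) (v : Torus d n → ℝ)
    (hv : ∀ z, ρ z ≤ d * l + i * (3 * l) → laplacian v z = μ * v z) :
    cubeSum d n l v k x ≤ ((2 + 2 * d) / l : ℝ) ^ i *
      ∑ z with ρ z ≤ d * l + i * (3 * l), v z ^ 2 := by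
  have hl' : (0 : ℝ) < l := by exact_mod_cast hl0
  induction i generalizing k v with
  | zero =>
    obtain rfl : k = d := by omega
    refine (cubeSum_le_sum_filter hl v hρ k le_rfl x).trans ?_
    simp only [pow_zero, one_mul, hx, zero_add, zero_mul, add_zero]
    refine Finset.sum_le_sum_of_subset_of_nonneg ?_ fun _ _ _ => sq_nonneg _
    intro z hz
    simp only [Finset.mem_filter, Finset.mem_univ, true_and] at hz ⊢
    exact hz.1
  | succ i ih =>
    have hk : k < d := by omega
    set s := d * l + i * (3 * l) with hs
    have hs' : d * l + (i + 1) * (3 * l) = s + 3 * l := by rw [hs]; ring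
    rw [hs'] at hv ⊢
    have h1 := cubeSum_le_succ l hl0 v ⟨k, hk⟩ x
    have h2 := ih (k + 1) (by omega) v fun z hz => hv z (by omega)
    -- The derivative solves the same equation wherever `z` and `z + e_k` both lie in the larger
    -- ball.
    have h3 := ih (k + 1) (by omega) (latticeDeriv (unitVec d n ⟨k, hk⟩) v) fun z hz => by
      have := (hρ ⟨k, hk⟩ z).1
      rw [laplacian_latticeDeriv, hv z (by omega), hv _ (by omega), latticeDeriv, mul_sub]
    have h4 := sum_sq_latticeDeriv_le_of_subharmonic hρ (s := s) hl0 (v := v) fun z hz => by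
      rw [hv z hz]
      nlinarith [mul_nonneg hμ (sq_nonneg (v z))]
    have h5 := Finset.single_le_sum
      (f := fun k => ∑ z with ρ z ≤ s, latticeDeriv (unitVec d n k) v z ^ 2)
      (fun i _ => Finset.sum_nonneg fun z _ => sq_nonneg _) (Finset.mem_univ (⟨k, hk⟩ : Fin d))
    have h6 : ∑ z with ρ z ≤ s, v z ^ 2 ≤ ∑ z with ρ z ≤ s + 3 * l, v z ^ 2 := by
      refine Finset.sum_le_sum_of_subset_of_nonneg ?_ fun _ _ _ => sq_nonneg _
      intro z hz
      simp only [Finset.mem_filter, Finset.mem_univ, true_and] at hz ⊢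
      omega
    set V := ∑ z with ρ z ≤ s + 3 * l, v z ^ 2
    set A : ℝ := ((2 + 2 * d) / l : ℝ) ^ i
    calc cubeSum d n l v k x
        ≤ 2 / l * (A * V) + 2 * l * (A * (d / (l : ℝ) ^ 2 * V)) := by
          refine h1.trans (add_le_add ?_ ?_)
          · refine mul_le_mul_of_nonneg_left (h2.trans ?_) (by positivity)
            exact mul_le_mul_of_nonneg_left h6 (by positivity)
          · refine mul_le_mul_of_nonneg_left (h3.trans ?_) (by positivity)
            exact mul_le_mul_of_nonneg_left (h5.trans h4) (by positivity)
      _ = ((2 + 2 * d) / l : ℝ) ^ (i + 1) * V := by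
          rw [pow_succ]
          change _ = A * _ * V
          field_simp

/-- The mean value inequality for the squares of massive harmonic functions. -/
theorem sq_le_of_massive_harmonic {l : ℕ} (hl0 : 0 < l) (hl : l ≤ n) {ρ : Torus d n → ℕ}
    (hρ : IsEdgeLipschitz ρ) {x : Torus d n} (hx : ρ x = 0) {μ : ℝ} (hμ : 0 ≤ μ)
    (v : Torus d n → ℝ) (hv : ∀ z, ρ z ≤ 4 * d * l → laplacian v z = μ * v z) :
    v x ^ 2 ≤ ((2 + 2 * d) / l : ℝ) ^ d * ∑ z, v z ^ 2 := by
  have h := cubeSum_le_of_massive_harmonic hl0 hl hρ hx hμ d 0 (zero_add d) v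
    fun z hz => hv z (hz.trans (le_of_eq (by ring)))
  refine h.trans (mul_le_mul_of_nonneg_left ?_ (by positivity))
  exact Finset.sum_le_sum_of_subset_of_nonneg (Finset.filter_subset _ _) fun _ _ _ => sq_nonneg _

end Regularity

/-! ### Graph distance on the torus and outer boundaries -/

section Distance

variable {d n : ℕ}

theorem edist_add_direction_le (x : Torus d n) {e : Torus d n} (he : e ∈ directions d n) :
    (torusGraph d n).edist x (x + e) ≤ 1 := by
  rw [SimpleGraph.edist_le_one_iff_adj_or_eq]
  by_cases h : x = x + e
  · exact Or.inr h
  · refine Or.inl ?_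
    rw [torusGraph, SimpleGraph.fromRel_adj]
    exact ⟨h, Or.inr ⟨e, he, rfl⟩⟩

theorem edist_add_nsmul_unitVec_le (x : Torus d n) (k : Fin d) (t : ℕ) :
    (torusGraph d n).edist x (x + t • unitVec d n k) ≤ t := by
  induction t with
  | zero => simp
  | succ t ih =>
    refine (SimpleGraph.edist_triangle (v := x + t • unitVec d n k)).trans ?_
    rw [succ_nsmul, ← add_assoc, Nat.cast_succ]
    exact add_le_add ih (edist_add_direction_le _ ⟨k, Or.inl rfl⟩)

variable [NeZero n]

/-- Correct one coordinate at a time. This yields connectedness, and it later forces the scale `l`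
to be at most `n`. -/
theorem edist_le (x y : Torus d n) : (torusGraph d n).edist x y ≤ (d * n : ℕ) := by
  have key : ∀ I : Finset (Fin d), (torusGraph d n).edist x
      (x + ∑ k ∈ I, ((y - x) k).val • unitVec d n k) ≤ (I.card * n : ℕ) := by
    intro I
    induction I using Finset.induction_on with
    | empty => simp
    | insert k I hk ih =>
      rw [Finset.sum_insert hk, Finset.card_insert_of_notMem hk, add_comm (_ • _), ← add_assoc,
        add_mul, one_mul, Nat.cast_add]
      refine SimpleGraph.edist_triangle.trans (add_le_add ih ?_)
      refine (edist_add_nsmul_unitVec_le _ k _).trans ?_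
      exact_mod_cast (ZMod.val_lt _).le
  have h := key Finset.univ
  have hy : x + ∑ k, ((y - x) k).val • unitVec d n k = y := by
    funext i
    simp [unitVec, Finset.sum_apply, Pi.single_apply, -ZMod.natCast_val, ZMod.natCast_zmod_val]
  rwa [hy, Finset.card_univ, Fintype.card_fin] at h

theorem torusGraph_connected : (torusGraph d n).Connected :=
  SimpleGraph.connected_iff _ |>.mpr ⟨fun x y => SimpleGraph.reachable_of_edist_ne_top
    (ne_top_of_le_ne_top (ENat.natCast_ne_top _) (edist_le x y)), inferInstance⟩

theorem coe_dist_eq_edist (x y : Torus d n) :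
    ((torusGraph d n).dist x y : ℕ∞) = (torusGraph d n).edist x y :=
  (torusGraph_connected x y).coe_dist_eq_edist

theorem dist_add_direction_le (x z : Torus d n) {e : Torus d n} (he : e ∈ directions d n) :
    (torusGraph d n).dist x (z + e) ≤ (torusGraph d n).dist x z + 1 := by
  refine (torusGraph_connected.dist_triangle (v := z)).trans (Nat.add_le_add_left ?_ _)
  have := edist_add_direction_le z he
  rw [← coe_dist_eq_edist] at this
  exact_mod_cast this

theorem isEdgeLipschitz_dist (x : Torus d n) : IsEdgeLipschitz ((torusGraph d n).dist x) := by
  refine fun k z => ⟨dist_add_direction_le x z ⟨k, Or.inl rfl⟩, ?_⟩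
  simpa using dist_add_direction_le x (z + unitVec d n k) ⟨k, Or.inr rfl⟩

theorem distTo_le {x y : Torus d n} {S : Finset (Torus d n)} (hy : y ∈ S) :
    distTo x S ≤ (torusGraph d n).dist x y := by
  rw [coe_dist_eq_edist]
  exact iInf₂_le y hy

theorem mem_outerBoundary_of_adj {X : Finset (Torus d n)} {x y : Torus d n} (hx : x ∈ X)
    (hy : y ∉ X) (h : (torusGraph d n).Adj x y) : y ∈ outerBoundary X := by
  classical
  rw [outerBoundary, Finset.mem_filter]
  refine ⟨Finset.mem_univ _, le_antisymm ?_ ?_⟩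
  · refine (iInf₂_le x hx).trans ?_
    rw [SimpleGraph.edist_comm]
    exact (SimpleGraph.edist_eq_one_iff_adj.mpr h).le
  · refine le_iInf₂ fun z hz => ?_
    rw [Order.one_le_iff_pos]
    exact SimpleGraph.edist_pos_of_ne fun h => hy (h ▸ hz)

theorem add_mem_or_mem_outerBoundary {X : Finset (Torus d n)} {x e : Torus d n} (hx : x ∈ X)
    (he : e ∈ directions d n) : x + e ∈ X ∨ x + e ∈ outerBoundary X := by
  by_cases h : x + e ∈ X
  · exact Or.inl h
  · refine Or.inr (mem_outerBoundary_of_adj hx h ?_)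
    exact (SimpleGraph.edist_le_one_iff_adj_or_eq.mp (edist_add_direction_le x he)).resolve_right
      fun h' => h (h' ▸ hx)

/-- A ball about `x ∈ X` that does not reach the outer boundary of `X` lies in `X`. -/
theorem mem_of_dist_lt_distTo {X : Finset (Torus d n)} {x z : Torus d n} (hx : x ∈ X)
    (hz : ((torusGraph d n).dist x z : ℕ∞) < distTo x (outerBoundary X)) : z ∈ X := by
  classical
  by_contra hzX
  obtain ⟨p, hp⟩ := torusGraph_connected.exists_walk_length_eq_dist x z
  obtain ⟨a, ha, ha1, ha2⟩ := p.exists_boundary_dart (X : Set (Torus d n)) hx hzX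
  have hb : a.snd ∈ outerBoundary X := mem_outerBoundary_of_adj ha1 ha2 a.adj
  have h1 := distTo_le (x := x) hb
  have h2 := SimpleGraph.dist_le (p.takeUntil a.snd (p.dart_snd_mem_support_of_mem_darts ha))
  have h3 := p.length_takeUntil_le_length (p.dart_snd_mem_support_of_mem_darts ha)
  have h4 : ((torusGraph d n).dist x a.snd : ℕ∞) ≤ (torusGraph d n).dist x z := by
    exact_mod_cast h2.trans (h3.trans hp.le)
  exact absurd (h1.trans h4) (not_le.mpr hz)

theorem distTo_le_of_nonempty {x : Torus d n} {S : Finset (Torus d n)} (hS : S.Nonempty) :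
    distTo x S ≤ (d * n : ℕ) := by
  obtain ⟨y, hy⟩ := hS
  exact (iInf₂_le y hy).trans (edist_le x y)

end Distance

/-! ### Gradient bound and the quadratic form -/

section Main

variable {d n : ℕ} [NeZero n]

/-- The gradient bound for functions that are massive harmonic in `X`. -/
theorem sq_latticeDeriv_le {m c A : ℝ} (hd : 0 < d) (hc : 0 < c) (hA : 0 < A)
    {X : Finset (Torus d n)} {x : Torus d n} (hx : x ∈ X) (hX : (outerBoundary X).Nonempty)
    (hxA : ENNReal.ofReal (c * A) ≤ (distTo x (outerBoundary X) : ENNReal))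
    {e : Torus d n} (he : e ∈ directions d n) {h : Torus d n → ℝ}
    (hh : ∀ z ∈ X, massiveOp m h z = 0) :
    latticeDeriv e h x ^ 2 ≤ ((2 + 2 * d) * (16 * d) / c) ^ d * (A ^ d)⁻¹ *
      ∑ z, h z * massiveOp m h z := by
  have hd' : (1 : ℝ) ≤ d := by exact_mod_cast hd
  have hcA : 0 < c * A := mul_pos hc hA
  set E := ∑ z, h z * massiveOp m h z
  have hE : 0 ≤ E := sum_mul_massiveOp_nonneg m h
  have hsum := sum_sq_latticeDeriv_le m h he
  obtain ⟨D, hD⟩ := ENat.ne_top_iff_exists.mp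
    (ne_top_of_le_ne_top (ENat.natCast_ne_top _) (distTo_le_of_nonempty (x := x) hX))
  have hDn : D ≤ d * n := by
    have := distTo_le_of_nonempty (x := x) hX
    rw [← hD] at this
    exact_mod_cast this
  have hAD : c * A ≤ D := by
    rw [← hD, ENat.toENNReal_coe, ENNReal.ofReal_le_natCast] at hxA
    exact hxA
  have hK : ((2 + 2 * d) * (16 * d) / c) ^ d * (A ^ d)⁻¹ =
      ((2 + 2 * d) * (16 * d) / (c * A) : ℝ) ^ d := by
    rw [← inv_pow, ← mul_pow]
    congr 1
    field_simp
  rw [hK]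
  -- The mean value inequality needs `Δ h = m² h` up to radius `4 * d * l + 1`, the extra one coming
  -- from the shift by `e`. For `l ≥ 1` this is less than `8 * d * l ≤ D`, while `c * A < 8 * d * (l
  -- + 1) ≤ 16 * d * l` gives the constant.
  set l := ⌊c * A / (8 * d)⌋₊ with hl
  have hl1 : (l : ℝ) ≤ c * A / (8 * d) := Nat.floor_le (by positivity)
  have hl2 : c * A / (8 * d) < l + 1 := Nat.lt_floor_add_one _
  rw [le_div_iff₀ (by positivity)] at hl1
  rw [div_lt_iff₀ (by positivity)] at hl2
  rcases Nat.eq_zero_or_pos l with h0 | hpos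
  -- Here `c * A < 8 * d`, the constant is at least `1`, and the trivial bound by the energy
  -- suffices.
  · have h1 : 1 ≤ (2 + 2 * d) * (16 * d) / (c * A) := by
      rw [le_div_iff₀ hcA]
      rw [h0] at hl2
      norm_num at hl2
      nlinarith
    calc latticeDeriv e h x ^ 2 ≤ ∑ z, latticeDeriv e h z ^ 2 :=
          Finset.single_le_sum (f := fun z => latticeDeriv e h z ^ 2) (fun _ _ => sq_nonneg _)
            (Finset.mem_univ x)
      _ ≤ 1 * E := by rw [one_mul]; exact hsum
      _ ≤ _ := mul_le_mul_of_nonneg_right (one_le_pow₀ h1) hE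
  · have hpos' : (1 : ℝ) ≤ l := by exact_mod_cast hpos
    have hln : l ≤ n := by
      have hDn' : (D : ℝ) ≤ d * n := by exact_mod_cast hDn
      have : (l : ℝ) * d ≤ n * d := by nlinarith
      exact_mod_cast le_of_mul_le_mul_right this (by linarith)
    have hlD : 4 * d * l + 1 < D := by
      have : (4 * d * l + 1 : ℝ) < D := by nlinarith
      exact_mod_cast this
    have hmem : ∀ z, (torusGraph d n).dist x z < D → z ∈ X := fun z hz =>
      mem_of_dist_lt_distTo hx (by rw [← hD]; exact_mod_cast hz)
    have hlap : ∀ z, (torusGraph d n).dist x z < D → laplacian h z = m ^ 2 * h z := by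
      intro z hz
      have := hh z (hmem z hz)
      rw [massiveOp] at this
      linarith
    have hmean := sq_le_of_massive_harmonic hpos hln (isEdgeLipschitz_dist x)
      SimpleGraph.dist_self (sq_nonneg m) (latticeDeriv e h) fun z hz => by
        have := dist_add_direction_le x z he
        rw [laplacian_latticeDeriv, hlap z (by omega), hlap _ (by omega), latticeDeriv, mul_sub]
    refine hmean.trans (mul_le_mul ?_ hsum (Finset.sum_nonneg fun _ _ => sq_nonneg _)
      (by positivity))
    refine pow_le_pow_left₀ (by positivity) ?_ d
    rw [div_le_div_iff₀ (by linarith) hcA, mul_assoc]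
    refine mul_le_mul_of_nonneg_left ?_ (by positivity)
    nlinarith

/-- The harmonic extension is given by the Poisson kernel on `X` and on its outer boundary. -/
theorem harmonicExtension_eq_sum {m : ℝ} (hm : 0 < m) (X : Finset (Torus d n))
    (u : Torus d n → ℝ) {z : Torus d n} (hz : z ∈ X ∨ z ∈ outerBoundary X) :
    harmonicExtension hm X u z = ∑ y ∈ outerBoundary X, poissonKernel hm X z y * u y := by
  classical
  have hP : ∀ y, IsDirichletSolution m X 0 (Pi.single y 1) fun z => poissonKernel hm X z y :=
    fun y => dirichletSolution_spec hm X 0 (Pi.single y 1)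
  set w : Torus d n → ℝ := fun z => ∑ y ∈ outerBoundary X, poissonKernel hm X z y * u y with hw
  -- The kernel sum need not agree with `u` beyond `∂X`, so it is replaced by `u` there. Neighbours
  -- of `X` lie in `X ∪ ∂X`, so the equation in `X` is unaffected and uniqueness applies.
  let w' : Torus d n → ℝ := fun z => if z ∈ X ∨ z ∈ outerBoundary X then w z else u z
  have hw' : IsDirichletSolution m X 0 u w' := by
    constructor
    · intro x hx
      have h1 : massiveOp m w' x = massiveOp m w x :=
        massiveOp_congr m (if_pos (Or.inl hx)) fun e he =>
          if_pos (add_mem_or_mem_outerBoundary hx he)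
      rw [h1, hw, massiveOp_sum_mul m (outerBoundary X) (fun y z => poissonKernel hm X z y) u x]
      exact Finset.sum_eq_zero fun y _ => by rw [(hP y).1 x hx, Pi.zero_apply, zero_mul]
    · intro x hx
      by_cases hb : x ∈ outerBoundary X
      · have h1 : w' x = w x := if_pos (Or.inr hb)
        have h2 : ∀ y, poissonKernel hm X x y = Pi.single (M := fun _ => ℝ) y 1 x :=
          fun y => (hP y).2 x hx
        rw [h1, hw]
        simp [h2, Pi.single_apply, hb]
      · exact if_neg (by tauto)
  have := (existsUnique_isDirichletSolution hm X 0 u).unique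
    (dirichletSolution_spec hm X 0 u) hw'
  rw [harmonicExtension, this]
  exact if_pos hz

/-- The potential vanishes off `U`, and on `U` the operator returns `g` restricted to `S`. Points of
`S` outside `U` contribute zero to both sides. -/
theorem greenFunction_quadratic_form {m : ℝ} (hm : 0 < m) (U S : Finset (Torus d n))
    (g : Torus d n → ℝ) :
    ∑ z, (∑ y ∈ S, greenFunction hm U z y * g y) *
        massiveOp m (fun z => ∑ y ∈ S, greenFunction hm U z y * g y) z =
      ∑ z ∈ S, g z * ∑ y ∈ S, greenFunction hm U z y * g y := by
  classical
  have hG : ∀ y, IsDirichletSolution m U (Pi.single y 1) 0 fun z => greenFunction hm U z y :=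
    fun y => dirichletSolution_spec hm U (Pi.single y 1) 0
  set w : Torus d n → ℝ := fun z => ∑ y ∈ S, greenFunction hm U z y * g y with hw
  have hz : ∀ z, w z * massiveOp m w z = if z ∈ S then g z * w z else 0 := by
    intro z
    by_cases hU : z ∈ U
    · have h1 : massiveOp m w z = ∑ y ∈ S, (Pi.single y 1 : Torus d n → ℝ) z * g y := by
        rw [hw, massiveOp_sum_mul m S (fun y z => greenFunction hm U z y) g z]
        exact Finset.sum_congr rfl fun y _ => by rw [(hG y).1 z hU]
      rw [h1]
      simp [Pi.single_apply, mul_comm]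
    · have h1 : w z = 0 := Finset.sum_eq_zero fun y _ => by
        have := (hG y).2 z hU
        simp only [Pi.zero_apply] at this
        rw [this, zero_mul]
      simp [h1]
  refine (Finset.sum_congr rfl fun z _ => hz z).trans ?_
  rw [Finset.sum_ite_mem, Finset.univ_inter]

theorem quadratic_form_le {m c A : ℝ} (hm : 0 < m) (hd : 0 < d) (hc : 0 < c) (hA : 0 < A)
    {X U : Finset (Torus d n)} {x : Torus d n} (hx : x ∈ X)
    (hxA : ENNReal.ofReal (c * A) ≤ (distTo x (outerBoundary X) : ENNReal))
    {e : Torus d n} (he : e ∈ directions d n) :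
    |∑ y₁ ∈ outerBoundary X, ∑ y₂ ∈ outerBoundary X,
        latticeDeriv e (fun z => poissonKernel hm X z y₁) x * greenFunction hm U y₁ y₂ *
          latticeDeriv e (fun z => poissonKernel hm X z y₂) x| ≤
      ((2 + 2 * d) * (16 * d) / c) ^ d * (A ^ d)⁻¹ := by
  set κ : ℝ := ((2 + 2 * d) * (16 * d) / c) ^ d * (A ^ d)⁻¹
  have hκ : 0 ≤ κ := by positivity
  rcases (outerBoundary X).eq_empty_or_nonempty with hX | hX
  · simpa [hX] using hκ
  set g : Torus d n → ℝ := fun y => latticeDeriv e (fun z => poissonKernel hm X z y) x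
  set u : Torus d n → ℝ := fun z => ∑ y ∈ outerBoundary X, greenFunction hm U z y * g y with hu
  set h := harmonicExtension hm X u
  set E := ∑ z, u z * massiveOp m u z with hE
  have hE0 : 0 ≤ E := sum_mul_massiveOp_nonneg m u
  have hEg : E = ∑ y ∈ outerBoundary X, g y * u y := greenFunction_quadratic_form hm U _ g
  have hsum : ∑ y₁ ∈ outerBoundary X, ∑ y₂ ∈ outerBoundary X,
      g y₁ * greenFunction hm U y₁ y₂ * g y₂ = E := by
    rw [hEg]
    refine Finset.sum_congr rfl fun y _ => ?_
    rw [hu, Finset.mul_sum]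
    exact Finset.sum_congr rfl fun y' _ => mul_assoc _ _ _
  -- The derivative of the Poisson representation is the pairing of `g` with `u`. The representation
  -- is also needed at `x + e`, which may lie in `∂X`.
  have hder : latticeDeriv e h x = E := by
    change harmonicExtension hm X u (x + e) - harmonicExtension hm X u x = E
    rw [hEg, harmonicExtension_eq_sum hm X u (Or.inl hx),
      harmonicExtension_eq_sum hm X u (add_mem_or_mem_outerBoundary hx he),
      ← Finset.sum_sub_distrib]
    exact Finset.sum_congr rfl fun y _ => (sub_mul _ _ _).symm
  have hgrad := sq_latticeDeriv_le hd hc hA hx hX hxA he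
    (dirichletSolution_spec hm X 0 u).1
  change latticeDeriv e h x ^ 2 ≤ κ * ∑ z, h z * massiveOp m h z at hgrad
  have hmin : ∑ z, h z * massiveOp m h z ≤ E := energy_harmonicExtension_le hm X u
  change |∑ y₁ ∈ outerBoundary X, ∑ y₂ ∈ outerBoundary X,
      g y₁ * greenFunction hm U y₁ y₂ * g y₂| ≤ κ
  rw [hsum, abs_of_nonneg hE0]
  rw [hder] at hgrad
  rcases hE0.eq_or_lt with h0 | hpos
  · rwa [← h0]
  · refine le_of_mul_le_mul_right ?_ hpos
    rw [← sq]
    exact hgrad.trans (mul_le_mul_of_nonneg_left hmin hκ)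

end Main

end DipoleGas

theorem mainTheorem4 (d : ℕ) (hd : 2 ≤ d) (c : ℝ) (hc : 0 < c) :
    ∃ K : ℝ, ∀ (L : ℕ) [NeZero L], Odd L → ∀ (N j : ℕ) (m : ℝ) (hm : 0 < m)
      (X U : Finset (DipoleGas.Torus d (L ^ N))), X ⊆ U →
      ∀ x ∈ X, ENNReal.ofReal (c * (L : ℝ) ^ j) ≤
          (DipoleGas.distTo x (DipoleGas.outerBoundary X) : ENNReal) →
      ∀ e ∈ DipoleGas.directions d (L ^ N),
        |∑ y₁ ∈ DipoleGas.outerBoundary X, ∑ y₂ ∈ DipoleGas.outerBoundary X,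
            DipoleGas.latticeDeriv e (fun z => DipoleGas.poissonKernel hm X z y₁) x *
              DipoleGas.greenFunction hm U y₁ y₂ *
              DipoleGas.latticeDeriv e (fun z => DipoleGas.poissonKernel hm X z y₂) x|
          ≤ K * ((L : ℝ) ^ (d * j))⁻¹ := by
  refine ⟨((2 + 2 * d) * (16 * d) / c) ^ d, fun L _ _ N j m hm X U _ x hx hxA e he => ?_⟩
  have hL : (0 : ℝ) < (L : ℝ) ^ j := by
    have : (0 : ℝ) < L := by exact_mod_cast Nat.pos_of_ne_zero (NeZero.ne L)
    positivity
  rw [mul_comm d j, pow_mul]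
  exact DipoleGas.quadratic_form_le hm (by omega) hc hL hx hxA he
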